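/- Let $X$ be a complex manifold (Hausdorff, finite-dimensional) with structure sheaf $\mathcal O_X$ and sheaf of holomorphic vector fields $T_X$. Let $\mathcal F \subseteq T_X$ be a subsheaf of $\mathcal O_X$-modules that is coherent, i.e. locally finitely generated: every point of $X$ has an open neighbourhood $U$ with finitely many $D_1,\dots,D_s \in H^0(U,\mathcal F)$ such that every section of $\mathcal F$ over an open subset of $U$ is locally an $\mathcal O_X$-linear combination of the $D_i$. Assume that $\mathcal F$ is closed under the Lie bracket of vector fields. For $r \in \mathbb N$ let $$X_r := \{\, x \in X \mid \operatorname{rank}(\mathcal F|_x \to T_X|_x) = r \,\},$$ where $\mathcal F|_x = \mathcal F_x/\mathfrak m_x\mathcal F_x$ is the fibre of $\mathcal F$ at $x$ and the map is induced by the inclusion; its image is the space of values at $x$ of sections of $\mathcal F$ defined near $x$. Let $r \in \mathbb N$, let $x \in X_r$, let $U$ be an open neighbourhood of $x$ and let $D \in H^0(U,\mathcal F)$. Let $\Delta \subset \mathbb C$ be an open disk centred at $0$ and let $\gamma_x : \Delta \to X$ be the integral curve of $D$ through $x$, i.e. a holomorphic map with $\gamma_x(0) = x$, $\gamma_x(\Delta)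 \subseteq U$ and $\gamma_x'(t) = D(\gamma_x(t))$ for all $t \in \Delta$. Then $\gamma_x(t) \in X_r$ for all $t \in \Delta$. -/

import Mathlib

open scoped Manifold ContDiff
open TopologicalSpace

noncomputable section

namespace FlowStrata

variable {E : Type*} [NormedAddCommGroup E] [NormedSpace ℂ E]
  {X : Type*} [TopologicalSpace X] [ChartedSpace E X]

/-- A (not necessarily holomorphic) vector field on the open subset `U` of `X`: a tangent vector
of `X` at every point of `U`. -/
abbrev VectorFieldOn (E : Type*) [NormedAddCommGroup E] [NormedSpace ℂ E]
    {X : Type*} [TopologicalSpace X] [ChartedSpace E X] (U : Opens X) :=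
  (x : U) → TangentSpace 𝓘(ℂ, E) (x : X)

/-- `f` is a holomorphic function on the open set `U`, i.e. a section of the structure sheaf. -/
def IsHolomorphicFun (E : Type*) [NormedAddCommGroup E] [NormedSpace ℂ E]
    {X : Type*} [TopologicalSpace X] [ChartedSpace E X] {U : Opens X} (f : U → ℂ) : Prop :=
  ContMDiff 𝓘(ℂ, E) 𝓘(ℂ, ℂ) ω f

namespace VectorFieldOn

/-- Restriction of a vector field to a smaller open set. -/
def restrict {U V : Opens X} (h : V ≤ U) (D : VectorFieldOn E U) : VectorFieldOn E V :=
  fun x => D ⟨x, h x.2⟩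

open Classical in
/-- Extension of a vector field by zero; only the values near points of `U` are ever used. -/
def extend {U : Opens X} (D : VectorFieldOn E U) : (x : X) → TangentSpace 𝓘(ℂ, E) x :=
  fun x => if h : x ∈ U then D ⟨x, h⟩ else 0

/-- The Lie bracket of two vector fields on the open set `U`. -/
def bracket {U : Opens X} (D₁ D₂ : VectorFieldOn E U) : VectorFieldOn E U :=
  fun x => VectorField.mlieBracket 𝓘(ℂ, E) D₁.extend D₂.extend (x : X)

variable [IsManifold 𝓘(ℂ, E) 1 X]

/-- The vector field `D` is holomorphic on `U`, i.e. it is a section of `T_X` over `U`. -/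
def IsHolomorphic {U : Opens X} (D : VectorFieldOn E U) : Prop :=
  ContMDiff 𝓘(ℂ, E) (𝓘(ℂ, E).tangent) ω
    (fun x : U => (⟨(x : X), D x⟩ : TangentBundle 𝓘(ℂ, E) X))

end VectorFieldOn

/-- A subsheaf of `𝒪_X`-modules of the sheaf `T_X` of holomorphic vector fields on `X`. -/
structure TangentSubsheaf (E : Type*) [NormedAddCommGroup E] [NormedSpace ℂ E]
    (X : Type*) [TopologicalSpace X] [ChartedSpace E X] [IsManifold 𝓘(ℂ, E) 1 X] where
  /-- The sections over an open set. -/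
  sections : (U : Opens X) → Set (VectorFieldOn E U)
  /-- Sections are holomorphic vector fields. -/
  holomorphic : ∀ {U : Opens X} {D : VectorFieldOn E U}, D ∈ sections U → D.IsHolomorphic
  zero_mem : ∀ U : Opens X, (0 : VectorFieldOn E U) ∈ sections U
  add_mem : ∀ {U : Opens X} {D₁ D₂ : VectorFieldOn E U},
    D₁ ∈ sections U → D₂ ∈ sections U → D₁ + D₂ ∈ sections U
  /-- Sections are stable under multiplication with holomorphic functions. -/
  smul_mem : ∀ {U : Opens X} {f : U → ℂ} {D : VectorFieldOn E U},
    IsHolomorphicFun E f → D ∈ sections U → (fun x => f x • D x) ∈ sections U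
  /-- Sections restrict to sections. -/
  restrict_mem : ∀ {U V : Opens X} (h : V ≤ U) {D : VectorFieldOn E U},
    D ∈ sections U → D.restrict h ∈ sections V
  /-- A vector field that is locally a section is a section. -/
  locality : ∀ {U : Opens X} {D : VectorFieldOn E U},
    (∀ x ∈ U, ∃ (V : Opens X) (h : V ≤ U), x ∈ V ∧ D.restrict h ∈ sections V) → D ∈ sections U

namespace TangentSubsheaf

variable [IsManifold 𝓘(ℂ, E) 1 X]

/-- The subsheaf is closed under the Lie bracket. -/
def IsInvolutive (F : TangentSubsheaf E X) : Prop :=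
  ∀ (U : Opens X) (D₁ D₂ : VectorFieldOn E U),
    D₁ ∈ F.sections U → D₂ ∈ F.sections U → D₁.bracket D₂ ∈ F.sections U

/-- The subsheaf is locally finitely generated: every point has an open neighbourhood `U` with
finitely many sections `D 0, …, D (s - 1)` over `U` such that every section over an open `V ⊆ U`
is locally a combination of them with holomorphic coefficients. For subsheaves of
`𝒪_X`-modules of `T_X` this is the same as coherence. -/
def IsLocallyFinitelyGenerated (F : TangentSubsheaf E X) : Prop :=
  ∀ x : X, ∃ U : Opens X, x ∈ U ∧ ∃ (s : ℕ) (D : Fin s → VectorFieldOn E U),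
    (∀ i, D i ∈ F.sections U) ∧
    ∀ (V : Opens X) (hV : V ≤ U) (D' : VectorFieldOn E V), D' ∈ F.sections V →
      ∀ y ∈ V, ∃ (W : Opens X) (hW : W ≤ V) (g : Fin s → W → ℂ), y ∈ W ∧
        (∀ i, IsHolomorphicFun E (g i)) ∧
        ∀ z : W, (D'.restrict hW) z = ∑ i, g i z • ((D i).restrict (hW.trans hV)) z

/-- The image of the fibre map `F|_x → T_X|_x`. The fibre `F|_x` is the quotient of the stalk of
`F` at `x` by the submodule generated by germs of functions vanishing at `x`, and the map is
evaluation at `x`; so its image consists of the values at `x` of the sections of `F` that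
are defined near `x`. -/
def fibreImage (F : TangentSubsheaf E X) (x : X) : Submodule ℂ (TangentSpace 𝓘(ℂ, E) x) where
  carrier := {v | ∃ (U : Opens X) (hx : x ∈ U), ∃ D ∈ F.sections U, D ⟨x, hx⟩ = v}
  zero_mem' := ⟨⊤, trivial, 0, F.zero_mem ⊤, rfl⟩
  add_mem' := by
    rintro _ _ ⟨U, hU, D, hD, rfl⟩ ⟨V, hV, D', hD', rfl⟩
    exact ⟨U ⊓ V, ⟨hU, hV⟩, D.restrict inf_le_left + D'.restrict inf_le_right,
      F.add_mem (F.restrict_mem _ hD) (F.restrict_mem _ hD'), rfl⟩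
  smul_mem' := by
    rintro c _ ⟨U, hU, D, hD, rfl⟩
    exact ⟨U, hU, _, F.smul_mem (f := fun _ => c) contMDiff_const hD, rfl⟩

/-- The locus `X_r` of points `x` at which the linear map `F|_x → T_X|_x` has rank `r`. -/
def stratum (F : TangentSubsheaf E X) (r : ℕ) : Set X :=
  {x | Module.finrank ℂ (F.fibreImage x) = r}

end TangentSubsheaf

/-- `γ`, restricted to the disk of radius `ε` about `0` in `ℂ`, is the integral curve
through `x` of the vector field `D` on `U`: it starts at `x`, stays in `U`, and is
complex differentiable with `γ' t = D (γ t)`. Values of `γ` outside the disk are irrelevant. -/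
structure IsIntegralCurve {U : Opens X} (D : VectorFieldOn E U) (x : X) (ε : ℝ) (γ : ℂ → X) :
    Prop where
  start : γ 0 = x
  deriv : ∀ t ∈ Metric.ball (0 : ℂ) ε, ∃ h : γ t ∈ U,
    HasMFDerivAt 𝓘(ℂ, ℂ) 𝓘(ℂ, E) γ t ((1 : ℂ →L[ℂ] ℂ).smulRight (D ⟨γ t, h⟩))

end FlowStrata

end

/-! Near a point `p` of the curve take generators `D' i` of the sheaf and, in the chart at `p`, let
`V t` be the linear map from `ℂ^s` whose columns are their values at `γ t`; its rank is that of the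
fibre map. Involutivity gives `[D, D' i] = ∑ j, g i j • D' j`. In coordinates this bracket is the
derivative of `D' i` along `D` minus that of `D` along `D' i`, so along the integral curve `V' = A V
+ V B`, where `A` is the derivative of `D` and `B` has columns `g i`. Such an equation preserves
rank: solving `Y' = -B Y` and `Z' = -Z A` from the identity makes `Z V Y` constant
(`finrank_range_le_of_linearODE`). Hence the rank is locally constant along `γ`
(`eventually_finrank_fibreImage_eq`), and so constant on the connected disk. -/

namespace FlowStrata

/-! ### Linear differential equations and rank -/

open Set Metric

/-- Global existence on `[0, 1]` for the ODE `y' = f s y`, when `f` is Lipschitz with a small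
constant and vanishes at the origin. -/
lemma exists_hasDerivWithinAt_of_small_lipschitz {G : Type*} [NormedAddCommGroup G]
    [NormedSpace ℝ G] [CompleteSpace G] (f : ℝ → G → G)
    (hcont : ∀ y, ContinuousOn (fun s => f s y) (Icc 0 1))
    (hlip : ∀ s ∈ Icc (0 : ℝ) 1, ∀ y z, ‖f s y - f s z‖ ≤ 1 / 4 * ‖y - z‖)
    (hzero : ∀ s, f s 0 = 0) (y₀ : G) :
    ∃ Y : ℝ → G, Y 0 = y₀ ∧
      ∀ s ∈ Icc (0 : ℝ) 1, HasDerivWithinAt Y (f s (Y s)) (Icc 0 1) s := by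
  -- On the ball of radius `‖y₀‖` about `y₀` one has `‖y‖ ≤ 2‖y₀‖`, so `‖f s y‖ ≤ ‖y₀‖ / 2`: the
  -- solution cannot leave the ball in unit time.
  have hP : IsPicardLindelof f (tmin := 0) (tmax := 1) ⟨0, by simp⟩ y₀ ‖y₀‖₊ 0 (‖y₀‖₊ / 2)
      (1 / 4) :=
    { lipschitzOnWith := fun s hs => LipschitzOnWith.of_dist_le_mul fun y _ z _ => by
        simpa [dist_eq_norm] using hlip s hs y z
      continuousOn := fun y _ => hcont y
      norm_le := fun s hs y hy => by
        have h1 := hlip s hs y 0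
        have h2 : ‖y - y₀‖ ≤ ‖y₀‖ := by simpa [dist_eq_norm] using hy
        have h3 : ‖y‖ ≤ ‖y - y₀‖ + ‖y₀‖ := by simpa using norm_add_le (y - y₀) y₀
        rw [hzero, sub_zero, sub_zero] at h1
        push_cast
        linarith
      mul_max_le := by
        have := norm_nonneg y₀
        simp }
  obtain ⟨Y, h0, hY⟩ := hP.exists_eq_forall_mem_Icc_hasDerivWithinAt₀
  exact ⟨Y, h0, hY⟩

variable {E F : Type*} [NormedAddCommGroup E] [NormedSpace ℂ E]
  [NormedAddCommGroup F] [NormedSpace ℂ F]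

lemma hasDerivWithinAt_clm_comp_real {G : Type*} [NormedAddCommGroup G] [NormedSpace ℂ G]
    {u : ℝ → F →L[ℂ] G} {v : ℝ → E →L[ℂ] F} {u' : F →L[ℂ] G} {v' : E →L[ℂ] F} {s : Set ℝ} {x : ℝ}
    (hu : HasDerivWithinAt u u' s x) (hv : HasDerivWithinAt v v' s x) :
    HasDerivWithinAt (fun y => (u y).comp (v y)) ((u x).comp v' + u'.comp (v x)) s x :=
  ((ContinuousLinearMap.compL ℂ E F G).bilinearRestrictScalars ℝ).hasDerivWithinAt_of_bilinear
    hu hv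

/-- The rank of a solution of `V' = A V + V B` does not decrease. -/
lemma finrank_range_le_of_linearODE [FiniteDimensional ℂ E] [FiniteDimensional ℂ F]
    (V : ℝ → F →L[ℂ] E) (A : ℝ → E →L[ℂ] E) (B : ℝ → F →L[ℂ] F)
    (hA : ContinuousOn A (Icc 0 1)) (hB : ContinuousOn B (Icc 0 1))
    (hA' : ∀ s ∈ Icc (0 : ℝ) 1, ‖A s‖ ≤ 1 / 4) (hB' : ∀ s ∈ Icc (0 : ℝ) 1, ‖B s‖ ≤ 1 / 4)
    (hV : ∀ s ∈ Icc (0 : ℝ) 1,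
      HasDerivWithinAt V ((A s).comp (V s) + (V s).comp (B s)) (Icc 0 1) s) :
    Module.finrank ℂ (V 0).range ≤ Module.finrank ℂ (V 1).range := by
  have := FiniteDimensional.complete ℂ E
  have := FiniteDimensional.complete ℂ F
  -- `Y` and `Z` are integrating factors cancelling `B` on the right and `A` on the left.
  obtain ⟨Y, hY0, hY⟩ := exists_hasDerivWithinAt_of_small_lipschitz
    (fun s Y => -(B s).comp Y) (fun y => (hB.clm_comp continuousOn_const).neg)
    (fun s hs y z => by
      rw [neg_sub_neg, ← ContinuousLinearMap.comp_sub, norm_sub_rev y z]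
      exact ((B s).opNorm_comp_le _).trans (by gcongr; exact hB' s hs))
    (by simp) (ContinuousLinearMap.id ℂ F)
  obtain ⟨Z, hZ0, hZ⟩ := exists_hasDerivWithinAt_of_small_lipschitz
    (fun s Z => -Z.comp (A s)) (fun y => (continuousOn_const.clm_comp hA).neg)
    (fun s hs y z => by
      rw [neg_sub_neg, ← ContinuousLinearMap.sub_comp, norm_sub_rev y z, mul_comm]
      exact ((z - y).opNorm_comp_le _).trans (by gcongr; exact hA' s hs))
    (by simp) (ContinuousLinearMap.id ℂ E)
  have hD : ∀ s ∈ Icc (0 : ℝ) 1,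
      HasDerivWithinAt (fun s => (Z s).comp ((V s).comp (Y s))) 0 (Icc 0 1) s := by
    intro s hs
    convert hasDerivWithinAt_clm_comp_real (hZ s hs)
      (hasDerivWithinAt_clm_comp_real (hV s hs) (hY s hs)) using 1
    ext x
    simp
  have key := constant_of_has_deriv_right_zero (fun s hs => (hD s hs).continuousWithinAt)
    (fun s hs => (hD s ⟨hs.1, hs.2.le⟩).mono_of_mem_nhdsWithin
      (Icc_mem_nhdsGE_of_mem hs)) 1 (by simp)
  simp only [hY0, hZ0, ContinuousLinearMap.id_comp, ContinuousLinearMap.comp_id] at key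
  -- This factorization alone bounds the rank of `V 0`; `Y 1` and `Z 1` need not be known to be
  -- invertible.
  have e : (V 0 : F →ₗ[ℂ] E) = (Z 1 : E →ₗ[ℂ] E) ∘ₗ (V 1 : F →ₗ[ℂ] E) ∘ₗ (Y 1 : F →ₗ[ℂ] F) := by
    rw [← key]; rfl
  change Module.finrank ℂ (V 0 : F →ₗ[ℂ] E).range ≤ Module.finrank ℂ (V 1 : F →ₗ[ℂ] E).range
  rw [e, LinearMap.range_comp]
  exact (Submodule.finrank_map_le _ _).trans
    (Submodule.finrank_mono (LinearMap.range_comp_le_range _ _))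

/-- The rank of a holomorphic solution of `V' = A V + V B` is locally constant. -/
lemma eventually_finrank_range_eq_of_linearODE [FiniteDimensional ℂ E] [FiniteDimensional ℂ F]
    (V : ℂ → F →L[ℂ] E) (A : ℂ → E →L[ℂ] E) (B : ℂ → F →L[ℂ] F) {t₀ : ℂ}
    (hA : ∀ᶠ t in nhds t₀, ContinuousAt A t) (hB : ∀ᶠ t in nhds t₀, ContinuousAt B t)
    (hV : ∀ᶠ t in nhds t₀, HasDerivAt V ((A t).comp (V t) + (V t).comp (B t)) t) :
    ∀ᶠ t in nhds t₀, Module.finrank ℂ (V t).range = Module.finrank ℂ (V t₀).range := by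
  have hA' : ∀ᶠ t in nhds t₀, ‖A t‖ < ‖A t₀‖ + 1 :=
    hA.self_of_nhds.norm.eventually_lt continuousAt_const (by simp)
  have hB' : ∀ᶠ t in nhds t₀, ‖B t‖ < ‖B t₀‖ + 1 :=
    hB.self_of_nhds.norm.eventually_lt continuousAt_const (by simp)
  obtain ⟨δ, hδ, H⟩ := Metric.eventually_nhds_iff_ball.mp (hA.and (hB.and (hV.and (hA'.and hB'))))
  -- `K` bounds both `‖A t‖` and `‖B t‖` on the ball of radius `δ`.
  set K := ‖A t₀‖ + ‖B t₀‖ + 1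
  have hKpos : 0 < K := by positivity
  have le_of_segment : ∀ a b : ℂ, a ∈ ball t₀ δ → b ∈ ball t₀ δ → ‖b - a‖ * K ≤ 1 / 4 →
      Module.finrank ℂ (V a).range ≤ Module.finrank ℂ (V b).range := by
    intro a b ha hb hab
    -- Along the real segment from `a` to `b` the chain rule multiplies `A` and `B` by `b - a`,
    -- which makes them small enough.
    set σ : ℝ → ℂ := fun s => a + (s : ℂ) * (b - a) with hσ
    have hσd : ∀ s, HasDerivAt σ (b - a) s := fun s => by
      have := (((hasDerivAt_id s).ofReal_comp).mul_const (b - a)).const_add a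
      rwa [Complex.ofReal_one, one_mul] at this
    have hmem : ∀ s ∈ Icc (0 : ℝ) 1, σ s ∈ ball t₀ δ := fun s hs => by
      have := (convex_ball t₀ δ).add_smul_sub_mem ha hb hs
      simpa [hσ] using this
    have hsmall : ∀ x, x ≤ K → ‖b - a‖ * x ≤ 1 / 4 := fun x hx =>
      (mul_le_mul_of_nonneg_left hx (norm_nonneg _)).trans hab
    have := finrank_range_le_of_linearODE (V ∘ σ) (fun s => (b - a) • A (σ s))
      (fun s => (b - a) • B (σ s))
      (fun s hs => by
        have h : ContinuousAt (fun s => A (σ s)) s :=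
          ContinuousAt.comp (f := σ) (H _ (hmem s hs)).1 (hσd s).continuousAt
        exact (h.const_smul (b - a)).continuousWithinAt)
      (fun s hs => by
        have h : ContinuousAt (fun s => B (σ s)) s :=
          ContinuousAt.comp (f := σ) (H _ (hmem s hs)).2.1 (hσd s).continuousAt
        exact (h.const_smul (b - a)).continuousWithinAt)
      (fun s hs => by
        rw [norm_smul]
        exact hsmall _ (by linarith [(H _ (hmem s hs)).2.2.2.1, norm_nonneg (B t₀)]))
      (fun s hs => by
        rw [norm_smul]
        exact hsmall _ (by linarith [(H _ (hmem s hs)).2.2.2.2, norm_nonneg (A t₀)]))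
      (fun s hs => by
        refine ((H _ (hmem s hs)).2.2.1.scomp s (hσd s)).hasDerivWithinAt.congr_deriv ?_
        rw [smul_add, ContinuousLinearMap.smul_comp, ContinuousLinearMap.comp_smul]
        rfl)
    have h0 : σ 0 = a := by simp [hσ]
    have h1 : σ 1 = b := by simp [hσ]
    rwa [Function.comp_apply, Function.comp_apply, h0, h1] at this
  filter_upwards [ball_mem_nhds t₀ hδ, ball_mem_nhds t₀ (show 0 < 1 / 4 / K by positivity)]
    with t ht ht'
  have h1 : ‖t - t₀‖ * K ≤ 1 / 4 := by
    rw [mem_ball, dist_eq_norm, lt_div_iff₀ hKpos] at ht'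
    exact ht'.le
  -- The segment traversed in both directions gives both inequalities.
  exact le_antisymm (le_of_segment _ _ ht (mem_ball_self hδ) (by rwa [norm_sub_rev]))
    (le_of_segment _ _ (mem_ball_self hδ) ht h1)

end FlowStrata

/-! ### Local generators and their brackets -/

namespace FlowStrata

open Set Metric VectorField

variable {E : Type*} [NormedAddCommGroup E] [NormedSpace ℂ E]
  {X : Type*} [TopologicalSpace X] [ChartedSpace E X]

lemma VectorFieldOn.extend_apply {U : Opens X} (D : VectorFieldOn E U) {x : X} (hx : x ∈ U) :
    D.extend x = D ⟨x, hx⟩ :=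
  dif_pos hx

lemma VectorFieldOn.extend_restrict_eventuallyEq {U V : Opens X} (h : V ≤ U)
    (D : VectorFieldOn E U) {x : X} (hx : x ∈ V) :
    (D.restrict h).extend =ᶠ[nhds x] D.extend := by
  filter_upwards [V.isOpen.mem_nhds hx] with y hy
  rw [VectorFieldOn.extend_apply _ hy, VectorFieldOn.extend_apply _ (h hy)]
  rfl

/-- A continuous function on an open subset, extended by an arbitrary value, is continuous at
the points of that subset. -/
lemma continuousAt_of_continuous_subtype {U : Opens X} {g : U → ℂ} (hg : Continuous g)
    {g' : X → ℂ} (h : ∀ z : U, g' z = g z) {x : X} (hx : x ∈ U) : ContinuousAt g' x := by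
  have hg' : (U : Set X).domRestrict g' = g := funext h
  have : ContinuousOn g' U := continuousOn_iff_continuous_domRestrict.mpr (hg' ▸ hg)
  exact this.continuousAt (U.isOpen.mem_nhds hx)

section

variable [IsManifold 𝓘(ℂ, E) 1 X]

lemma VectorFieldOn.IsHolomorphic.contMDiffAt_extend {U : Opens X} {D : VectorFieldOn E U}
    (hD : D.IsHolomorphic) {x : X} (hx : x ∈ U) :
    ContMDiffAt 𝓘(ℂ, E) (𝓘(ℂ, E).tangent) ω
      (fun y => (⟨y, D.extend y⟩ : TangentBundle 𝓘(ℂ, E) X)) x := by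
  rw [← contMDiffAt_subtype_iff (U := U) (x := ⟨x, hx⟩)]
  convert hD ⟨x, hx⟩ using 3 with y
  exact VectorFieldOn.extend_apply D y.2

namespace TangentSubsheaf

/-- Local generators span the image of the fibre map. -/
lemma fibreImage_eq_span (F : TangentSubsheaf E X) {U : Opens X} {s : ℕ}
    {D : Fin s → VectorFieldOn E U} (hD : ∀ i, D i ∈ F.sections U)
    (hgen : ∀ (V : Opens X) (hV : V ≤ U) (D' : VectorFieldOn E V), D' ∈ F.sections V →
      ∀ y ∈ V, ∃ (W : Opens X) (hW : W ≤ V) (g : Fin s → W → ℂ), y ∈ W ∧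
        (∀ i, IsHolomorphicFun E (g i)) ∧
        ∀ z : W, (D'.restrict hW) z = ∑ i, g i z • ((D i).restrict (hW.trans hV)) z)
    {q : X} (hq : q ∈ U) :
    F.fibreImage q = Submodule.span ℂ (range fun i => (D i).extend q) := by
  apply le_antisymm
  · rintro _ ⟨V, hV, D', hD', rfl⟩
    obtain ⟨W, hW, g, hqW, -, h⟩ := hgen (V ⊓ U) inf_le_right (D'.restrict inf_le_left)
      (F.restrict_mem _ hD') q ⟨hV, hq⟩
    have h' : D' ⟨q, hV⟩ = ∑ i, g i ⟨q, hqW⟩ • (D i).extend q := by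
      simp_rw [VectorFieldOn.extend_apply _ hq]
      exact h ⟨q, hqW⟩
    rw [h']
    exact Submodule.sum_mem _ fun i _ =>
      Submodule.smul_mem _ _ (Submodule.subset_span (mem_range_self i))
  · rw [Submodule.span_le]
    rintro _ ⟨i, rfl⟩
    exact ⟨U, hq, D i, hD i, (VectorFieldOn.extend_apply _ hq).symm⟩

/-- Brackets with local generators are, near a given point, combinations of the generators with
continuous coefficients. -/
lemma exists_bracket_eq_sum (F : TangentSubsheaf E X) (hLie : F.IsInvolutive) {U : Opens X} {s : ℕ}
    {D : Fin s → VectorFieldOn E U} (hD : ∀ i, D i ∈ F.sections U)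
    (hgen : ∀ (V : Opens X) (hV : V ≤ U) (D' : VectorFieldOn E V), D' ∈ F.sections V →
      ∀ y ∈ V, ∃ (W : Opens X) (hW : W ≤ V) (g : Fin s → W → ℂ), y ∈ W ∧
        (∀ i, IsHolomorphicFun E (g i)) ∧
        ∀ z : W, (D'.restrict hW) z = ∑ i, g i z • ((D i).restrict (hW.trans hV)) z)
    {U' : Opens X} {D' : VectorFieldOn E U'} (hD' : D' ∈ F.sections U') {p : X} (hp : p ∈ U)
    (hp' : p ∈ U') (i : Fin s) :
    ∃ g : Fin s → X → ℂ, ∀ᶠ q in nhds p, (∀ j, ContinuousAt (g j) q) ∧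
      mlieBracket 𝓘(ℂ, E) D'.extend (D i).extend q = ∑ j, g j q • (D j).extend q := by
  classical
  obtain ⟨W, hW, g, hpW, hg, h⟩ := hgen (U' ⊓ U) inf_le_right
    ((D'.restrict inf_le_left).bracket ((D i).restrict inf_le_right))
    (hLie _ _ _ (F.restrict_mem _ hD') (F.restrict_mem _ (hD i))) p ⟨hp', hp⟩
  refine ⟨fun j q => if hq : q ∈ W then g j ⟨q, hq⟩ else 0, ?_⟩
  filter_upwards [W.isOpen.mem_nhds hpW] with q hq
  refine ⟨fun j => continuousAt_of_continuous_subtype (hg j).continuous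
    (fun z => dif_pos z.2) hq, ?_⟩
  have hq' : q ∈ W := hq
  have key := h ⟨q, hq⟩
  simp only [dif_pos hq', VectorFieldOn.extend_apply _ (hW hq).2]
  refine Eq.trans ?_ key
  -- The bracket at `q` depends only on germs, so restricting the fields to `U' ⊓ U` does not change
  -- it.
  exact ((VectorFieldOn.extend_restrict_eventuallyEq inf_le_left D'
    (hW hq)).mlieBracket_vectorField_eq
    (VectorFieldOn.extend_restrict_eventuallyEq inf_le_right (D i) (hW hq))).symm

end TangentSubsheaf

end

/-! ### Vector fields in a chart -/

/-- A vector field, read in the chart at `p`. -/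
noncomputable def chartField (p : X) (W : (x : X) → TangentSpace 𝓘(ℂ, E) x) : E → E :=
  mpullback 𝓘(ℂ, E) 𝓘(ℂ, E) (extChartAt 𝓘(ℂ, E) p).symm W

/-- The map `c ↦ ∑ i, c i • v i`. -/
noncomputable def combMap {s : ℕ} (v : Fin s → E) : (Fin s → ℂ) →L[ℂ] E :=
  ∑ i, (ContinuousLinearMap.proj (R := ℂ) (φ := fun _ : Fin s => ℂ) i).smulRight (v i)

lemma combMap_apply {s : ℕ} (v : Fin s → E) (c : Fin s → ℂ) : combMap v c = ∑ i, c i • v i := by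
  simp [combMap]

lemma range_combMap {s : ℕ} (v : Fin s → E) :
    (combMap v).range = Submodule.span ℂ (range v) := by
  rw [← Fintype.range_linearCombination ℂ]
  congr 1
  ext c
  simp [combMap_apply, Fintype.linearCombination_apply]

lemma hasDerivAt_combMap {s : ℕ} {v : Fin s → ℂ → E} {v' : Fin s → E} {t : ℂ}
    (h : ∀ i, HasDerivAt (v i) (v' i) t) :
    HasDerivAt (fun t => combMap fun i => v i t) (combMap v') t :=
  HasDerivAt.fun_sum fun i _ =>
    (ContinuousLinearMap.smulRightL ℂ (Fin s → ℂ) E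
      (ContinuousLinearMap.proj (R := ℂ) (φ := fun _ : Fin s => ℂ) i)).hasFDerivAt.comp_hasDerivAt t
      (h i)

lemma continuousAt_combMap {s : ℕ} {v : Fin s → ℂ → E} {t : ℂ}
    (h : ∀ i, ContinuousAt (v i) t) : ContinuousAt (fun t => combMap fun i => v i t) t := by
  refine tendsto_finsetSum _ fun i _ => ?_
  exact (ContinuousLinearMap.continuous (ContinuousLinearMap.smulRightL ℂ (Fin s → ℂ) E
      (ContinuousLinearMap.proj (R := ℂ) (φ := fun _ : Fin s => ℂ) i))).continuousAt.comp (h i)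

variable [IsManifold 𝓘(ℂ, E) ω X]

lemma isInvertible_mfderiv_extChartAt_symm {p : X} {y : E}
    (hy : y ∈ (extChartAt 𝓘(ℂ, E) p).target) :
    (mfderiv 𝓘(ℂ, E) 𝓘(ℂ, E) (extChartAt 𝓘(ℂ, E) p).symm y).IsInvertible := by
  have : IsManifold 𝓘(ℂ, E) 1 X := IsManifold.of_le (n := ω) le_top
  have h := isInvertible_mfderivWithin_extChartAt_symm (I := 𝓘(ℂ, E)) hy
  rwa [ModelWithCorners.range_eq_univ, mfderivWithin_univ] at h

lemma contMDiffAt_extChartAt_symm {p : X} {y : E}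
    (hy : y ∈ (extChartAt 𝓘(ℂ, E) p).target) :
    ContMDiffAt 𝓘(ℂ, E) 𝓘(ℂ, E) ω (extChartAt 𝓘(ℂ, E) p).symm y := by
  have h := contMDiffWithinAt_extChartAt_symm_range (I := 𝓘(ℂ, E)) (n := ω) p hy
  rwa [ModelWithCorners.range_eq_univ, contMDiffWithinAt_univ] at h

/-- The pullback inverts the derivative of the inverse chart, and that inverse is the derivative of
the chart. -/
lemma chartField_apply {p q : X} (hq : q ∈ (extChartAt 𝓘(ℂ, E) p).source)
    (W : (x : X) → TangentSpace 𝓘(ℂ, E) x) :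
    chartField p W (extChartAt 𝓘(ℂ, E) p q) =
      mfderiv 𝓘(ℂ, E) 𝓘(ℂ, E) (extChartAt 𝓘(ℂ, E) p) q (W q) := by
  have : IsManifold 𝓘(ℂ, E) 1 X := IsManifold.of_le (n := ω) le_top
  have hy := (extChartAt 𝓘(ℂ, E) p).map_source hq
  have h := mfderivWithin_extChartAt_symm_comp_mfderiv_extChartAt' (I := 𝓘(ℂ, E)) hq
  rw [ModelWithCorners.range_eq_univ, mfderivWithin_univ] at h
  refine (isInvertible_mfderiv_extChartAt_symm hy).inverse_apply_eq.mpr ?_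
  have h2 := DFunLike.congr_fun h (W q)
  -- The two values lie in different tangent spaces, both of which are `E` by definition.
  have h3 : ((W ((extChartAt 𝓘(ℂ, E) p).symm (extChartAt 𝓘(ℂ, E) p q)) : E)) = W q :=
    congrArg (fun z => (W z : E)) ((extChartAt 𝓘(ℂ, E) p).left_inv hq)
  exact h3.trans h2.symm

lemma contDiffAt_chartField [CompleteSpace E] {p : X} {y : E}
    {W : (x : X) → TangentSpace 𝓘(ℂ, E) x}
    (hy : y ∈ (extChartAt 𝓘(ℂ, E) p).target)
    (hW : ContMDiffAt 𝓘(ℂ, E) (𝓘(ℂ, E).tangent) ω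
      (fun z => (⟨z, W z⟩ : TangentBundle 𝓘(ℂ, E) X)) ((extChartAt 𝓘(ℂ, E) p).symm y)) :
    ContDiffAt ℂ ω (chartField p W) y := by
  have : IsManifold 𝓘(ℂ, E) 1 X := IsManifold.of_le (n := ω) le_top
  refine contMDiffAt_vectorSpace_iff_contDiffAt.mp ?_
  exact hW.mpullback_vectorField_preimage (contMDiffAt_extChartAt_symm hy)
    (isInvertible_mfderiv_extChartAt_symm hy) le_top

lemma mlieBracket_apply_vectorSpace {E : Type*} [NormedAddCommGroup E] [NormedSpace ℂ E]
    (V W : E → E) (y : E) :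
    mlieBracket 𝓘(ℂ, E) V W y = fderiv ℂ W y (V y) - fderiv ℂ V y (W y) := by
  exact (congrFun (mlieBracketWithin_eq_lieBracketWithin (V := V) (W := W) (s := univ)) y).trans
    (congrFun lieBracketWithin_univ y)

/-- Brackets commute with pullback along the inverse chart, which leaves the coordinate formula in
`E`. -/
lemma chartField_mlieBracket [CompleteSpace E] {p : X} {y : E}
    {V W : (x : X) → TangentSpace 𝓘(ℂ, E) x}
    (hy : y ∈ (extChartAt 𝓘(ℂ, E) p).target)
    (hV : ContMDiffAt 𝓘(ℂ, E) (𝓘(ℂ, E).tangent) ω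
      (fun z => (⟨z, V z⟩ : TangentBundle 𝓘(ℂ, E) X)) ((extChartAt 𝓘(ℂ, E) p).symm y))
    (hW : ContMDiffAt 𝓘(ℂ, E) (𝓘(ℂ, E).tangent) ω
      (fun z => (⟨z, W z⟩ : TangentBundle 𝓘(ℂ, E) X)) ((extChartAt 𝓘(ℂ, E) p).symm y)) :
    chartField p (mlieBracket 𝓘(ℂ, E) V W) y =
      fderiv ℂ (chartField p W) y (chartField p V y) -
        fderiv ℂ (chartField p V) y (chartField p W y) := by
  have : IsManifold 𝓘(ℂ, E) (minSmoothness ℂ 3) X := IsManifold.of_le (n := ω) le_top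
  have h := mpullback_mlieBracket (I := 𝓘(ℂ, E)) (hV.mdifferentiableAt (by simp))
    (hW.mdifferentiableAt (by simp)) (contMDiffAt_extChartAt_symm hy) le_top
  exact h.trans (mlieBracket_apply_vectorSpace _ _ y)

lemma finrank_span_chartField {p q : X} (hq : q ∈ (extChartAt 𝓘(ℂ, E) p).source) {s : ℕ}
    (W : Fin s → (x : X) → TangentSpace 𝓘(ℂ, E) x) :
    Module.finrank ℂ (Submodule.span ℂ
      (range fun i => chartField p (W i) (extChartAt 𝓘(ℂ, E) p q))) =
    Module.finrank ℂ (Submodule.span ℂ (range fun i => W i q)) := by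
  have : IsManifold 𝓘(ℂ, E) 1 X := IsManifold.of_le (n := ω) le_top
  set L : E →L[ℂ] E := mfderiv 𝓘(ℂ, E) 𝓘(ℂ, E) (extChartAt 𝓘(ℂ, E) p) q
  have hL : Function.Injective L := (isInvertible_mfderiv_extChartAt (I := 𝓘(ℂ, E)) hq).injective
  let v : Fin s → E := fun i => W i q
  have h : (fun i => chartField p (W i) (extChartAt 𝓘(ℂ, E) p q)) = L ∘ v :=
    funext fun i => chartField_apply hq (W i)
  have hspan : Submodule.span ℂ (range (L ∘ v)) =
      (Submodule.span ℂ (range v)).map (L : E →ₗ[ℂ] E) := by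
    rw [Submodule.map_span, range_comp]
    rfl
  rw [h, hspan]
  exact (Submodule.equivMapOfInjective (L : E →ₗ[ℂ] E) hL (Submodule.span ℂ (range v))).finrank_eq.symm

lemma chartField_eq_sum {p q : X} (hq : q ∈ (extChartAt 𝓘(ℂ, E) p).source) {s : ℕ}
    {V : (x : X) → TangentSpace 𝓘(ℂ, E) x} {W : Fin s → (x : X) → TangentSpace 𝓘(ℂ, E) x}
    {c : Fin s → ℂ} (h : V q = ∑ j, c j • W j q) :
    chartField p V (extChartAt 𝓘(ℂ, E) p q) =
      ∑ j, c j • chartField p (W j) (extChartAt 𝓘(ℂ, E) p q) := by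
  have : IsManifold 𝓘(ℂ, E) 1 X := IsManifold.of_le (n := ω) le_top
  set L : E →L[ℂ] E := mfderiv 𝓘(ℂ, E) 𝓘(ℂ, E) (extChartAt 𝓘(ℂ, E) p) q
  let v : E := V q
  let w : Fin s → E := fun i => W i q
  have hv : chartField p V (extChartAt 𝓘(ℂ, E) p q) = L v := chartField_apply hq V
  have hw : ∀ i, chartField p (W i) (extChartAt 𝓘(ℂ, E) p q) = L (w i) :=
    fun i => chartField_apply hq (W i)
  have h' : v = ∑ j, c j • w j := h
  simp_rw [hv, hw, h', map_sum, map_smul]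

lemma hasDerivAt_extChartAt_comp {p : X} {γ : ℂ → X} {t : ℂ}
    (ht : γ t ∈ (extChartAt 𝓘(ℂ, E) p).source) {V : (x : X) → TangentSpace 𝓘(ℂ, E) x}
    (hγ : HasMFDerivAt 𝓘(ℂ, ℂ) 𝓘(ℂ, E) γ t ((1 : ℂ →L[ℂ] ℂ).smulRight (V (γ t)))) :
    HasDerivAt (fun t => extChartAt 𝓘(ℂ, E) p (γ t))
      (chartField p V (extChartAt 𝓘(ℂ, E) p (γ t))) t := by
  have : IsManifold 𝓘(ℂ, E) 1 X := IsManifold.of_le (n := ω) le_top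
  set L : E →L[ℂ] E := mfderiv 𝓘(ℂ, E) 𝓘(ℂ, E) (extChartAt 𝓘(ℂ, E) p) (γ t)
  let v : E := V (γ t)
  have hφd : HasMFDerivAt 𝓘(ℂ, E) 𝓘(ℂ, E) (extChartAt 𝓘(ℂ, E) p) (γ t) L :=
    (mdifferentiableAt_extChartAt (by simpa using ht)).hasMFDerivAt
  have h2 : HasFDerivAt (fun t => extChartAt 𝓘(ℂ, E) p (γ t))
      (L.comp ((1 : ℂ →L[ℂ] ℂ).smulRight v)) t := (hφd.comp t hγ).hasFDerivAt
  have hv : chartField p V (extChartAt 𝓘(ℂ, E) p (γ t)) = L v := chartField_apply ht V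
  rw [hv]
  exact h2.hasDerivAt.congr_deriv (by simp)

/-! ### Local constancy of the rank along integral curves -/

/-- Along an integral curve of a section of an involutive, locally finitely generated subsheaf,
the rank of the fibre map is locally constant. -/
lemma eventually_finrank_fibreImage_eq [FiniteDimensional ℂ E] (F : TangentSubsheaf E X)
    (hfg : F.IsLocallyFinitelyGenerated) (hLie : F.IsInvolutive)
    {U : Opens X} {D : VectorFieldOn E U} (hD : D ∈ F.sections U) {γ : ℂ → X} {t₀ : ℂ}
    (hγ : ∀ᶠ t in nhds t₀, ∃ h : γ t ∈ U,
      HasMFDerivAt 𝓘(ℂ, ℂ) 𝓘(ℂ, E) γ t ((1 : ℂ →L[ℂ] ℂ).smulRight (D ⟨γ t, h⟩))) :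
    ∀ᶠ t in nhds t₀, Module.finrank ℂ (F.fibreImage (γ t)) =
      Module.finrank ℂ (F.fibreImage (γ t₀)) := by
  have := FiniteDimensional.complete ℂ E
  have : IsManifold 𝓘(ℂ, E) 1 X := IsManifold.of_le (n := ω) le_top
  obtain ⟨O, hpO, s, D', hD', hgen⟩ := hfg (γ t₀)
  obtain ⟨hpU, hγ₀⟩ := hγ.self_of_nhds
  choose g hg using fun i => F.exists_bracket_eq_sum hLie hD' hgen hD hpO hpU i
  set p := γ t₀
  set φ := extChartAt 𝓘(ℂ, E) p
  have hgood : ∀ᶠ t in nhds t₀, γ t ∈ φ.source ∧ γ t ∈ O ∧ ∀ i, (∀ j, ContinuousAt (g i j) (γ t)) ∧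
      mlieBracket 𝓘(ℂ, E) D.extend (D' i).extend (γ t) =
        ∑ j, g i j (γ t) • (D' j).extend (γ t) :=
    hγ₀.continuousAt.eventually (Filter.Eventually.and (extChartAt_source_mem_nhds (I := 𝓘(ℂ, E)) p)
      (Filter.Eventually.and (O.isOpen.mem_nhds hpO) (Filter.eventually_all.mpr hg)))
  -- The three maps are `V`, `A` and `B`; column `i` of `B` is the coefficient vector of `[D, D'
  -- i]`.
  have key := eventually_finrank_range_eq_of_linearODE (t₀ := t₀)
    (fun t => combMap fun i => chartField p (D' i).extend (φ (γ t)))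
    (fun t => fderiv ℂ (chartField p D.extend) (φ (γ t)))
    (fun t => combMap fun i j => g i j (γ t)) ?_ ?_ ?_
  · filter_upwards [key, hgood] with t ht h
    rw [range_combMap, range_combMap, finrank_span_chartField h.1,
      finrank_span_chartField (mem_extChartAt_source p)] at ht
    rw [F.fibreImage_eq_span hD' hgen h.2.1, F.fibreImage_eq_span hD' hgen hpO]
    exact ht
  · filter_upwards [hγ, hgood] with t ⟨hU, ht⟩ h
    have hy := φ.map_source h.1
    have hsymm : φ.symm (φ (γ t)) = γ t := φ.left_inv h.1
    have hφc : ContinuousAt (fun t => φ (γ t)) t :=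
      ContinuousAt.comp (g := φ) (continuousAt_extChartAt' h.1) ht.continuousAt
    refine ContinuousAt.comp (g := fderiv ℂ (chartField p D.extend)) ?_ hφc
    have h1 := contDiffAt_chartField (W := D.extend) hy
      (by rw [hsymm]; exact (F.holomorphic hD).contMDiffAt_extend hU)
    exact (h1.fderiv_right (m := ω) le_top).continuousAt
  · filter_upwards [hγ, hgood] with t ⟨hU, ht⟩ h
    refine continuousAt_combMap (v := fun i t j => g i j (γ t)) fun i => ?_
    exact continuousAt_pi.mpr fun j => ContinuousAt.comp (f := γ) ((h.2.2 i).1 j) ht.continuousAt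
  · filter_upwards [hγ, hgood] with t ⟨hU, ht⟩ h
    have hy := φ.map_source h.1
    have hsymm : φ.symm (φ (γ t)) = γ t := φ.left_inv h.1
    have hDt := (F.holomorphic hD).contMDiffAt_extend hU
    have hDi := fun i => (F.holomorphic (hD' i)).contMDiffAt_extend h.2.1
    have hc : HasDerivAt (fun t => φ (γ t)) (chartField p D.extend (φ (γ t))) t :=
      hasDerivAt_extChartAt_comp h.1 (by rwa [VectorFieldOn.extend_apply D hU])
    refine (hasDerivAt_combMap (v := fun i t => chartField p (D' i).extend (φ (γ t))) fun i =>
      (((contDiffAt_chartField (W := (D' i).extend) hy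
        (by rw [hsymm]; exact hDi i)).differentiableAt
        (by simp)).hasFDerivAt.comp_hasDerivAt t hc)).congr_deriv ?_
    -- The bracket formula, solved for the derivative of `D' i` along `D`: this is column `i` of `V'
    -- = A V + V B`.
    have hbr : ∀ i, fderiv ℂ (chartField p (D' i).extend) (φ (γ t))
        (chartField p D.extend (φ (γ t))) =
        fderiv ℂ (chartField p D.extend) (φ (γ t)) (chartField p (D' i).extend (φ (γ t))) +
        ∑ j, g i j (γ t) • chartField p (D' j).extend (φ (γ t)) := by
      intro i
      rw [← sub_eq_iff_eq_add', ← chartField_mlieBracket hy (by rw [hsymm]; exact hDt)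
        (by rw [hsymm]; exact hDi i)]
      exact chartField_eq_sum h.1 (h.2.2 i).2
    refine ContinuousLinearMap.ext fun c => ?_
    simp only [hbr, combMap_apply, add_apply, ContinuousLinearMap.comp_apply,
      map_sum, map_smul, smul_add, Finset.sum_add_distrib]

end FlowStrata

theorem proposition5p2
    {E : Type*} [NormedAddCommGroup E] [NormedSpace ℂ E] [FiniteDimensional ℂ E]
    {X : Type*} [TopologicalSpace X] [T2Space X] [ChartedSpace E X]
    [IsManifold 𝓘(ℂ, E) ω X]
    (F : FlowStrata.TangentSubsheaf E X)
    (hfg : F.IsLocallyFinitelyGenerated) (hLie : F.IsInvolutive)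
    (r : ℕ) (x : X) (hx : x ∈ F.stratum r)
    (U : Opens X) (hxU : x ∈ U)
    (D : FlowStrata.VectorFieldOn E U) (hD : D ∈ F.sections U)
    (ε : ℝ) (hε : 0 < ε) (γ : ℂ → X) (hγ : FlowStrata.IsIntegralCurve D x ε γ) :
    ∀ t ∈ Metric.ball (0 : ℂ) ε, γ t ∈ F.stratum r := by
  intro t ht
  have h0 : (0 : ℂ) ∈ Metric.ball (0 : ℂ) ε := Metric.mem_ball_self hε
  -- A locally constant function is continuous into the discrete space `ℕ`, hence constant on a
  -- preconnected set.
  have hconst := (convex_ball (0 : ℂ) ε).isPreconnected.constant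
    (f := fun t => Module.finrank ℂ (F.fibreImage (γ t)))
    (fun a ha => ContinuousAt.continuousWithinAt (by
      have h := FlowStrata.eventually_finrank_fibreImage_eq F hfg hLie hD (t₀ := a)
        (Filter.eventually_of_mem (Metric.isOpen_ball.mem_nhds ha) hγ.deriv)
      exact continuousAt_const.congr (h.mono fun _ h => h.symm))) ht h0
  have h1 : Module.finrank ℂ (F.fibreImage (γ 0)) = r := by rw [hγ.start]; exact hx
  exact Eq.trans hconst h1
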